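/- Let $K$ be a field and let $L$ be a nilpotent Lie algebra over $K$ of class $c$ (that is, $L^{c+1}=0$, and $L^c\neq 0$ if $c\ge 1$, where $L^1=L$ and $L^{i+1}=[L,L^i]$) which is generated, as a Lie algebra, by $n$ elements. Let $M(L)$ be the Schur multiplier of $L$: for a free presentation $L\cong F/R$, with $F$ a free Lie algebra over $K$ and $R$ an ideal of $F$, $M(L)=(F^2\cap R)/[F,R]$, where $F^2=[F,F]$. Then, for every free presentation of $L$, $M(L)$ is finite dimensional and $$\dim M(L)\le \sum_{j=1}^{c} l_n(j+1),\qquad\text{where}\qquad l_n(q)=\frac1q\sum_{s\mid q}\mu(s)\,n^{q/s}$$ and $\mu$ is the Möbius function. -/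

import Mathlib

/-- The Hopf quotient `(F² ∩ R) / [F, R]` attached to a homomorphism `p : F → L` of Lie algebras
with kernel `R`, where `F² = [F, F]`. It is formed as a vector space: `[F, R]`, seen inside
`F² ∩ R`, is divided out. When `F` is free and `p` is onto, so that `L ≅ F / R` is a free
presentation of `L`, this is the Schur multiplier `M(L)`. -/
abbrev SchurMultiplier {K F L : Type*} [Field K] [LieRing F] [LieAlgebra K F]
    [LieRing L] [LieAlgebra K L] (p : F →ₗ⁅K⁆ L) : Type _ :=
  ((⁅(⊤ : LieIdeal K F), (⊤ : LieIdeal K F)⁆ ⊓ p.ker : LieIdeal K F).toSubmodule) ⧸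
    Submodule.comap
      ((⁅(⊤ : LieIdeal K F), (⊤ : LieIdeal K F)⁆ ⊓ p.ker : LieIdeal K F).toSubmodule).subtype
      (⁅(⊤ : LieIdeal K F), p.ker⁆ : LieIdeal K F).toSubmodule

/-- Witt's number `l_n(q) = (1/q) ∑_{s ∣ q} μ(s) n^{q/s}`, as a rational number. -/
def wittNumber (n q : ℕ) : ℚ :=
  (1 / (q : ℚ)) * ∑ s ∈ q.divisors, (ArithmeticFunction.moebius s : ℚ) * (n : ℚ) ^ (q / s)

/-! Write `L ≅ F/R`. The algebra `N = F/[F,R]` has class at most `c + 1`, and `R/[F,R]` is central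
in it, so all commutators of `N` are commutators of the subalgebra generated by lifts of the `n`
generators. `M(L)` embeds in `[N,N]`, so it suffices to span these commutators
(`exists_finiteDimensional_forall_lie_mem`). This is done by Lazard elimination
(`exists_spanning_family`): removing a generator `x` of weight `w` replaces the other generators `y`
by all `(ad x)^i y`. If `S` and `S'` are the weight series before and after, then `1 - S = (1 -
X^w)(1 - S')`. Weights above `q = c + 1` carry only zero, so the product of `1 - X^w` over the
eliminated elements agrees with `1 - nX` through degree `q`. Logarithmic derivatives and Möbius
inversion turn this into Witt's numbers (`count_eq_wittNumber`). An upper bound needs only spanning,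
never independence. -/

/-! ### Witt's formula from a product of power series. -/

section WittCount

open PowerSeries

/-- The power series `∑_{k ≥ 1} w X ^ (w k)`, that is, minus `X` times the logarithmic derivative of
`1 - X ^ w`. -/
def logDerivSeries (w : ℕ) : ℚ⟦X⟧ :=
  PowerSeries.mk fun m => if w ∣ m ∧ m ≠ 0 then (w : ℚ) else 0

theorem one_sub_X_pow_mul_logDerivSeries {w : ℕ} (hw : 1 ≤ w) :
    (1 - (X : ℚ⟦X⟧) ^ w) * logDerivSeries w = (w : ℚ⟦X⟧) * X ^ w := by
  ext m
  rw [sub_mul, one_mul, map_sub, coeff_X_pow_mul', ← map_natCast (C (R := ℚ)), coeff_C_mul,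
    coeff_X_pow]
  simp only [logDerivSeries, coeff_mk]
  rcases lt_trichotomy m w with h | rfl | h
  · have h1 : ¬ (w ∣ m ∧ m ≠ 0) := fun ⟨h1, h2⟩ =>
      absurd (Nat.le_of_dvd (Nat.pos_of_ne_zero h2) h1) (by omega)
    simp [h1, h.ne, h]
  · have : m ≠ 0 := by omega
    simp [this]
  · have h1 : w ∣ m - w ↔ w ∣ m := (Nat.dvd_sub_iff_left h.le dvd_rfl)
    have h2 : m - w ≠ 0 := by omega
    have h3 : m ≠ 0 := by omega
    simp [h1, h2, h3, h.le, h.ne']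

theorem X_mul_derivative_one_sub_X_pow {w : ℕ} (hw : 1 ≤ w) :
    X * derivative ℚ (1 - (X : ℚ⟦X⟧) ^ w) = -((1 - X ^ w) * logDerivSeries w) := by
  rw [one_sub_X_pow_mul_logDerivSeries hw, map_sub, derivative_one, derivative_pow, derivative_X]
  obtain ⟨v, rfl⟩ : ∃ v, w = v + 1 := ⟨w - 1, by omega⟩
  simp only [Nat.add_sub_cancel]
  ring

theorem X_mul_derivative_prod (W : Multiset ℕ) (hW : ∀ w ∈ W, 1 ≤ w) :
    X * derivative ℚ (W.map fun w => 1 - (X : ℚ⟦X⟧) ^ w).prod =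
      -((W.map fun w => 1 - (X : ℚ⟦X⟧) ^ w).prod * (W.map logDerivSeries).sum) := by
  induction W using Multiset.induction with
  | empty => simp
  | cons w W ih =>
    have h1 := ih fun v hv => hW v (Multiset.mem_cons_of_mem hv)
    have h2 := X_mul_derivative_one_sub_X_pow (hW w (Multiset.mem_cons_self w W))
    simp only [Multiset.map_cons, Multiset.prod_cons, Multiset.sum_cons, Derivation.leibniz,
      smul_eq_mul]
    linear_combination (1 - X ^ w) * h1 + (W.map fun w => 1 - (X : ℚ⟦X⟧) ^ w).prod * h2

/-- The factor `X` restores the degree lost by differentiating, so congruences modulo `X^(q+1)`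
survive. -/
theorem X_pow_dvd_X_mul_derivative {f : ℚ⟦X⟧} {q : ℕ} (h : X ^ (q + 1) ∣ f) :
    X ^ (q + 1) ∣ X * derivative ℚ f := by
  obtain ⟨g, rfl⟩ := h
  rw [Derivation.leibniz, derivative_pow, derivative_X]
  refine ⟨X * derivative ℚ g + g * ((q + 1 : ℕ) : ℚ⟦X⟧), ?_⟩
  simp only [smul_eq_mul, Nat.add_sub_cancel]
  ring

theorem coeff_sum_logDerivSeries (W : Multiset ℕ) {m : ℕ} (hm : m ≠ 0) :
    coeff m (W.map logDerivSeries).sum = ∑ d ∈ m.divisors, (d : ℚ) * W.count d := by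
  induction W using Multiset.induction with
  | empty => simp
  | cons w W ih =>
    rw [Multiset.map_cons, Multiset.sum_cons, map_add, ih]
    simp only [Multiset.count_cons, Nat.cast_add, mul_add, Finset.sum_add_distrib]
    rw [add_comm]
    congr 1
    simp [logDerivSeries, hm]

theorem sum_divisors_mul_count {n q : ℕ} (W : Multiset ℕ) (hW : ∀ w ∈ W, 1 ≤ w)
    (h : (X : ℚ⟦X⟧) ^ (q + 1) ∣ (W.map fun w => 1 - (X : ℚ⟦X⟧) ^ w).prod - (1 - (n : ℚ⟦X⟧) * X))
    {m : ℕ} (hm : 1 ≤ m) (hmq : m ≤ q) :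
    ∑ d ∈ m.divisors, (d : ℚ) * W.count d = (n : ℚ) ^ m := by
  have h1 := X_mul_derivative_prod W hW
  set P := (W.map fun w => 1 - (X : ℚ⟦X⟧) ^ w).prod
  set S := (W.map logDerivSeries).sum
  have h2 := X_pow_dvd_X_mul_derivative h
  have h3 : derivative ℚ (1 - (n : ℚ⟦X⟧) * X) = -(n : ℚ⟦X⟧) := by
    simp [Derivation.leibniz]
  rw [map_sub, h3, mul_sub, h1] at h2
  have h4 : (1 - (n : ℚ⟦X⟧) * X) * PowerSeries.mk (fun k => (n : ℚ) ^ k) = 1 := by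
    ext k
    rw [sub_mul, one_mul, map_sub, mul_assoc, ← map_natCast (C (R := ℚ)), coeff_C_mul]
    cases k with
    | zero => simp
    | succ k => simp [coeff_succ_X_mul, coeff_one, pow_succ']
  set G := PowerSeries.mk (fun k => (n : ℚ) ^ k)
  -- `P S ≡ nX` and `P ≡ 1 - nX`; multiplying by `G = 1/(1 - nX)` gives `S ≡ nX G`.
  have h5 : X ^ (q + 1) ∣ S - C (n : ℚ) * (X * G) := by
    have := dvd_add (h2.mul_left G) (h.mul_left (G * S))
    refine (dvd_neg.mpr this).trans (dvd_of_eq ?_)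
    rw [map_natCast]
    linear_combination S * h4
  rw [X_pow_dvd_iff] at h5
  have h6 := h5 m (by omega)
  rw [map_sub, coeff_sum_logDerivSeries W (by omega), coeff_C_mul, sub_eq_zero] at h6
  rw [h6]
  obtain ⟨k, rfl⟩ : ∃ k, m = k + 1 := ⟨m - 1, by omega⟩
  simp [G, coeff_succ_X_mul, pow_succ']

/-- If `∏_{w ∈ W} (1 - X ^ w)` agrees with `1 - n X` up to degree `q`, then the multiplicities in
`W` of the numbers up to `q` are Witt's numbers. -/
theorem count_eq_wittNumber {n q : ℕ} (W : Multiset ℕ) (hW : ∀ w ∈ W, 1 ≤ w)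
    (h : (X : ℚ⟦X⟧) ^ (q + 1) ∣ (W.map fun w => 1 - (X : ℚ⟦X⟧) ^ w).prod - (1 - (n : ℚ⟦X⟧) * X))
    {m : ℕ} (hm : 1 ≤ m) (hmq : m ≤ q) : (W.count m : ℚ) = wittNumber n m := by
  -- The divisor sums are known only up to `q`; inversion still works because `{1, …, q}` is closed
  -- under divisors.
  have key := (ArithmeticFunction.sum_eq_iff_sum_mul_moebius_eq_on
    (f := fun d => (d : ℚ) * W.count d) (g := fun m => (n : ℚ) ^ m) {k | 1 ≤ k ∧ k ≤ q}
    (fun a b hab hb => ⟨Nat.pos_of_dvd_of_pos hab hb.1, (Nat.le_of_dvd hb.1 hab).trans hb.2⟩)).mp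
    (fun k _ hk => sum_divisors_mul_count W hW h hk.1 hk.2) m hm ⟨hm, hmq⟩
  rw [Nat.sum_divisorsAntidiagonal
    (f := fun a b => (ArithmeticFunction.moebius a : ℚ) * (n : ℚ) ^ b)] at key
  have hm0 : (m : ℚ) ≠ 0 := by exact_mod_cast (by omega : m ≠ 0)
  rw [wittNumber, key]
  field_simp

end WittCount

/-! ### Lazard elimination with weights. -/

section Elimination

variable {K N : Type*} [Field K] [LieRing N] [LieAlgebra K N]

/-- A Lie subalgebra generated by a set `Z` of elements that the derivation `ad x` maps into it is
stable under `ad x`. -/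
theorem lie_mem_lieSpan_of_forall_generator {x : N} {Z : Set N}
    (hZ : ∀ z ∈ Z, ⁅x, z⁆ ∈ LieSubalgebra.lieSpan K N Z) {h : N}
    (hh : h ∈ LieSubalgebra.lieSpan K N Z) : ⁅x, h⁆ ∈ LieSubalgebra.lieSpan K N Z := by
  induction hh using LieSubalgebra.lieSpan_induction with
  | mem z hz => exact hZ z hz
  | zero => simp
  | add a b _ _ ha hb => rw [lie_add]; exact add_mem ha hb
  | smul t a _ ha => rw [lie_smul]; exact LieSubalgebra.smul_mem _ t ha
  | lie a b ha' hb' ha hb =>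
    rw [leibniz_lie]
    exact add_mem (LieSubalgebra.lie_mem _ ha hb') (LieSubalgebra.lie_mem _ ha' hb)

/-- Lazard elimination: if `H` is stable under `ad x`, then `K x + H` is a Lie subalgebra. -/
theorem exists_smul_add_of_mem_lieSpan {x : N} {H : LieSubalgebra K N}
    (hx : ∀ h ∈ H, ⁅x, h⁆ ∈ H) {Y : Set N} (hY : ∀ y ∈ Y, y = x ∨ y ∈ H) {u : N}
    (hu : u ∈ LieSubalgebra.lieSpan K N Y) : ∃ a : K, ∃ h ∈ H, u = a • x + h := by
  induction hu using LieSubalgebra.lieSpan_induction with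
  | mem y hy =>
    rcases hY y hy with rfl | h
    · exact ⟨1, 0, H.zero_mem, by simp⟩
    · exact ⟨0, y, h, by simp⟩
  | zero => exact ⟨0, 0, H.zero_mem, by simp⟩
  | add u v _ _ hu hv =>
    obtain ⟨a, h, hh, rfl⟩ := hu
    obtain ⟨b, k, hk, rfl⟩ := hv
    exact ⟨a + b, h + k, H.add_mem hh hk, by module⟩
  | smul t u _ hu =>
    obtain ⟨a, h, hh, rfl⟩ := hu
    exact ⟨t * a, t • h, H.smul_mem t hh, by module⟩
  | lie u v _ _ hu hv =>
    obtain ⟨a, h, hh, rfl⟩ := hu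
    obtain ⟨b, k, hk, rfl⟩ := hv
    refine ⟨0, a • ⁅x, k⁆ - b • ⁅x, h⁆ + ⁅h, k⁆, H.add_mem (H.sub_mem (H.smul_mem a (hx k hk))
      (H.smul_mem b (hx h hh))) (H.lie_mem hh hk), ?_⟩
    simp only [add_lie, lie_add, smul_lie, lie_smul, lie_self, smul_zero, zero_smul, ← lie_skew x h]
    module

/-- The bracket of two elements of `K x + H` lies in any subspace that contains `[x, Z]` and
`[H, H]`, where `Z` generates `H`. -/
theorem lie_smul_add_mem {x : N} {Z : Set N} {V : Submodule K N}
    (hxZ : ∀ z ∈ Z, ⁅x, z⁆ ∈ LieSubalgebra.lieSpan K N Z)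
    (hZV : ∀ z ∈ Z, ⁅x, z⁆ ∈ V)
    (hV : ∀ u ∈ LieSubalgebra.lieSpan K N Z, ∀ v ∈ LieSubalgebra.lieSpan K N Z, ⁅u, v⁆ ∈ V)
    {Y : Set N} (hY : ∀ y ∈ Y, y = x ∨ y ∈ LieSubalgebra.lieSpan K N Z) {u v : N}
    (hu : u ∈ LieSubalgebra.lieSpan K N Y) (hv : v ∈ LieSubalgebra.lieSpan K N Y) :
    ⁅u, v⁆ ∈ V := by
  have stable : ∀ h ∈ LieSubalgebra.lieSpan K N Z, ⁅x, h⁆ ∈ LieSubalgebra.lieSpan K N Z :=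
    fun h hh => lie_mem_lieSpan_of_forall_generator hxZ hh
  have hxV : ∀ h ∈ LieSubalgebra.lieSpan K N Z, ⁅x, h⁆ ∈ V := by
    intro h hh
    induction hh using LieSubalgebra.lieSpan_induction with
    | mem z hz => exact hZV z hz
    | zero => simp
    | add a b _ _ ha hb => rw [lie_add]; exact add_mem ha hb
    | smul t a _ ha => rw [lie_smul]; exact V.smul_mem t ha
    | lie a b ha hb _ _ =>
      rw [leibniz_lie]
      exact add_mem (hV _ (stable a ha) _ hb) (hV _ ha _ (stable b hb))
  obtain ⟨a, h, hh, rfl⟩ := exists_smul_add_of_mem_lieSpan stable hY hu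
  obtain ⟨b, k, hk, rfl⟩ := exists_smul_add_of_mem_lieSpan stable hY hv
  have : ⁅a • x + h, b • x + k⁆ = a • ⁅x, k⁆ - b • ⁅x, h⁆ + ⁅h, k⁆ := by
    simp only [add_lie, lie_add, smul_lie, lie_smul, lie_self, smul_zero, ← lie_skew x h]
    module
  rw [this]
  exact add_mem (sub_mem (V.smul_mem a (hxV k hk)) (V.smul_mem b (hxV h hh))) (hV h hh k hk)

open PowerSeries

/-- The generating function of the weights of a family of weighted elements. -/
noncomputable def weightSeries (B : Multiset (N × ℕ)) : ℚ⟦X⟧ := (B.map fun b => (X : ℚ⟦X⟧) ^ b.2).sum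

/-- The product of the factors `1 - X ^ w` over the weights `w` of a family. -/
noncomputable def weightProd (B : Multiset (N × ℕ)) : ℚ⟦X⟧ := (B.map fun b => 1 - (X : ℚ⟦X⟧) ^ b.2).prod

/-- The weighted elements `(ad x) ^ i y`, for `y` in `B` and `i` in `s`, where `x` has weight
`d`. -/
def adPowers (x : N) (d : ℕ) (s : Finset ℕ) (B : Multiset (N × ℕ)) : Multiset (N × ℕ) :=
  B.bind fun b => s.val.map fun i => (((LieAlgebra.ad K N x) ^ i) b.1, b.2 + i * d)

theorem mem_adPowers {x : N} {d : ℕ} {s : Finset ℕ} {B : Multiset (N × ℕ)} {z : N × ℕ} :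
    z ∈ adPowers (K := K) x d s B ↔
      ∃ b ∈ B, ∃ i ∈ s, (((LieAlgebra.ad K N x) ^ i) b.1, b.2 + i * d) = z := by
  simp [adPowers, Multiset.mem_bind]

omit [LieRing N] in
theorem weightSeries_add (A B : Multiset (N × ℕ)) :
    weightSeries (A + B) = weightSeries A + weightSeries B := by
  simp [weightSeries]

theorem weightSeries_adPowers (x : N) (d : ℕ) (s : Finset ℕ) (B : Multiset (N × ℕ)) :
    weightSeries (adPowers (K := K) x d s B) = weightSeries B * ∑ i ∈ s, (X ^ d) ^ i := by
  induction B using Multiset.induction with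
  | empty => simp [weightSeries, adPowers]
  | cons b B ih =>
    have h : weightSeries (adPowers (K := K) x d s (b ::ₘ B)) =
        X ^ b.2 * ∑ i ∈ s, (X ^ d) ^ i + weightSeries (adPowers (K := K) x d s B) := by
      simp only [weightSeries, adPowers, Multiset.cons_bind, Multiset.map_add, Multiset.sum_add,
        Multiset.map_map, Function.comp_def, Finset.mul_sum]
      congr 1
      exact Finset.sum_congr rfl fun i _ => by rw [pow_add, mul_comm i d, pow_mul]
    rw [h, ih]
    simp only [weightSeries, Multiset.map_cons, Multiset.sum_cons]
    ring

omit [LieRing N] in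
theorem X_pow_dvd_weightProd_sub_one {m : ℕ} {A : Multiset (N × ℕ)} (hA : ∀ a ∈ A, m ≤ a.2) :
    (X : ℚ⟦X⟧) ^ m ∣ weightProd A - 1 := by
  induction A using Multiset.induction with
  | empty => simp [weightProd]
  | cons a A ih =>
    have h1 := ih fun b hb => hA b (Multiset.mem_cons_of_mem hb)
    have h2 : (X : ℚ⟦X⟧) ^ m ∣ X ^ a.2 := pow_dvd_pow _ (hA a (Multiset.mem_cons_self a A))
    have h3 : weightProd (a ::ₘ A) = (1 - X ^ a.2) * weightProd A := by simp [weightProd]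
    refine (dvd_sub h1 (h2.mul_right (weightProd A))).trans (dvd_of_eq ?_)
    rw [h3]
    ring

theorem ad_pow_mem {Fil : ℕ → Submodule K N}
    (hFil : ∀ i j, ∀ u ∈ Fil i, ∀ v ∈ Fil j, ⁅u, v⁆ ∈ Fil (i + j)) {x y : N} {d w : ℕ}
    (hx : x ∈ Fil d) (hy : y ∈ Fil w) (i : ℕ) :
    ((LieAlgebra.ad K N x) ^ i) y ∈ Fil (w + i * d) := by
  induction i with
  | zero => simpa using hy
  | succ i ih =>
    rw [pow_succ', show w + (i + 1) * d = d + (w + i * d) by ring]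
    exact hFil _ _ _ hx _ ih

/-- Eliminating all generators in turn, in order of their weights: the commutators of the Lie
algebra generated by `A + B`, where the elements of `A` have weight `d` and those of `B` larger
weights, lie in the span of a family whose weights are determined up to degree `q`. -/
theorem exists_spanning_family (Fil : ℕ → Submodule K N) {q : ℕ}
    (hFil : ∀ i j, ∀ u ∈ Fil i, ∀ v ∈ Fil j, ⁅u, v⁆ ∈ Fil (i + j))
    (hq : ∀ m, q < m → Fil m = ⊥) {k d : ℕ} (hd : 1 ≤ d) (hk : q + 1 ≤ k + d)
    (A B : Multiset (N × ℕ)) (hA : ∀ a ∈ A, a.2 = d ∧ a.1 ∈ Fil a.2)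
    (hB : ∀ b ∈ B, d < b.2 ∧ b.1 ∈ Fil b.2) :
    ∃ b : Multiset (N × ℕ), (∀ z ∈ b, d < z.2 ∧ z.1 ∈ Fil z.2) ∧
      (∀ y ∈ B, y.1 ∈ Submodule.span K {z | ∃ y ∈ b, y.1 = z}) ∧
      (∀ u ∈ LieSubalgebra.lieSpan K N {z | ∃ y ∈ A + B, y.1 = z},
        ∀ v ∈ LieSubalgebra.lieSpan K N {z | ∃ y ∈ A + B, y.1 = z},
          ⁅u, v⁆ ∈ Submodule.span K {z | ∃ y ∈ b, y.1 = z}) ∧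
      X ^ (q + 1) ∣ weightProd A * weightProd b - (1 - weightSeries (A + B)) := by
  -- `k` bounds how far `d` is below `q + 1`. At `k = 0` every generator vanishes; otherwise an
  -- inner induction eliminates `A` one element at a time, and once `A` is empty `d` is raised.
  induction k generalizing d A B with
  | zero =>
    have hz : ∀ y ∈ A + B, y.1 = 0 ∧ q + 1 ≤ y.2 := by
      intro y hy
      have h1 : q < y.2 ∧ y.1 ∈ Fil y.2 := by
        rcases Multiset.mem_add.mp hy with h | h
        · exact ⟨by have := (hA y h).1; omega, (hA y h).2⟩
        · exact ⟨by have := (hB y h).1; omega, (hB y h).2⟩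
      obtain ⟨h1, h2⟩ := h1
      rw [hq _ h1] at h2
      exact ⟨by simpa using h2, h1⟩
    refine ⟨0, by simp, fun y hy => ?_, fun u hu v _ => ?_, ?_⟩
    · rw [(hz y (Multiset.mem_add.mpr (Or.inr hy))).1]; exact zero_mem _
    · have hbot : LieSubalgebra.lieSpan K N {z | ∃ y ∈ A + B, y.1 = z} ≤ ⊥ := by
        rw [LieSubalgebra.lieSpan_le]
        rintro _ ⟨y, hy, rfl⟩
        simpa using (hz y hy).1
      have : u = 0 := by simpa using hbot hu
      rw [this, zero_lie]; exact zero_mem _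
    · have h1 : (X : ℚ⟦X⟧) ^ (q + 1) ∣ weightSeries (A + B) := by
        refine Multiset.dvd_sum fun f hf => ?_
        obtain ⟨y, hy, rfl⟩ := Multiset.mem_map.mp hf
        exact pow_dvd_pow _ (hz y hy).2
      have h2 : (X : ℚ⟦X⟧) ^ (q + 1) ∣ weightProd A - 1 :=
        X_pow_dvd_weightProd_sub_one fun a ha =>
          (hz a (Multiset.mem_add.mpr (Or.inl ha))).2
      refine (dvd_add h2 h1).trans (dvd_of_eq ?_)
      simp [weightProd]
      ring
  | succ k ihk =>
    induction A using Multiset.induction generalizing B with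
    | empty =>
      set A₁ := B.filter fun y => y.2 = d + 1 with hA₁
      set B₁ := B.filter fun y => ¬ y.2 = d + 1 with hB₁
      have hAB : A₁ + B₁ = B := Multiset.filter_add_not _ B
      obtain ⟨b, hb1, hb2, hb3, hb4⟩ := ihk (d := d + 1) (by omega) (by omega) A₁ B₁
        (fun a ha => by
          obtain ⟨h1, h2⟩ := Multiset.mem_filter.mp ha
          exact ⟨h2, (hB a h1).2⟩)
        (fun a ha => by
          obtain ⟨h1, h2⟩ := Multiset.mem_filter.mp ha
          have := hB a h1
          exact ⟨by omega, this.2⟩)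
      rw [hAB] at hb3 hb4
      have hmono : Submodule.span K {z | ∃ y ∈ b, y.1 = z} ≤
          Submodule.span K {z | ∃ y ∈ A₁ + b, y.1 = z} :=
        Submodule.span_mono fun z ⟨y, hy, hz⟩ => ⟨y, Multiset.mem_add.mpr (Or.inr hy), hz⟩
      -- The elements of weight `d + 1` are about to be eliminated, so they join the spanning family
      -- themselves.
      refine ⟨A₁ + b, fun z hz => ?_, fun y hy => ?_, fun u hu v hv => ?_, ?_⟩
      · rcases Multiset.mem_add.mp hz with h | h
        · exact hB z (Multiset.mem_filter.mp h).1
        · exact ⟨by have := (hb1 z h).1; omega, (hb1 z h).2⟩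
      · rw [← hAB] at hy
        rcases Multiset.mem_add.mp hy with h | h
        · exact Submodule.subset_span ⟨y, Multiset.mem_add.mpr (Or.inl h), rfl⟩
        · exact hmono (hb2 y h)
      · rw [zero_add] at hu hv
        exact hmono (hb3 u hu v hv)
      · rw [zero_add]
        refine hb4.trans (dvd_of_eq ?_)
        simp [weightProd]
    | cons x A ih =>
      obtain ⟨x, w⟩ := x
      obtain ⟨rfl, hx⟩ : w = d ∧ x ∈ Fil w := hA _ (Multiset.mem_cons_self _ _)
      -- `A` itself stays in the list, so its powers start at `i = 1`; this keeps all weights in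
      -- `B'` above `w`.
      set B' := adPowers (K := K) x w (Finset.Ioc 0 q) A +
        adPowers (K := K) x w (Finset.Icc 0 q) B with hB'
      have hAC : ∀ a ∈ A, a.2 = w ∧ a.1 ∈ Fil a.2 :=
        fun a ha => hA a (Multiset.mem_cons_of_mem ha)
      obtain ⟨b, hb1, hb2, hb3, hb4⟩ := ih B' hAC (by
        intro z hz
        rcases Multiset.mem_add.mp hz with h | h
        · obtain ⟨y, hy, i, hi, rfl⟩ := mem_adPowers.mp h
          refine ⟨?_, ad_pow_mem hFil hx (hAC y hy).2 i⟩
          have h1 := (Finset.mem_Ioc.mp hi).1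
          have h2 := (hAC y hy).1
          have := Nat.mul_pos h1 hd
          simp only
          omega
        · obtain ⟨y, hy, i, hi, rfl⟩ := mem_adPowers.mp h
          refine ⟨?_, ad_pow_mem hFil hx (hB y hy).2 i⟩
          have h2 := (hB y hy).1
          simp only
          omega)
      set V := Submodule.span K {z | ∃ y ∈ b, y.1 = z}
      set Z := {z | ∃ y ∈ A + B', y.1 = z} with hZ
      have hBB' : ∀ y ∈ B, y ∈ B' := fun y hy =>
        Multiset.mem_add.mpr (Or.inr (mem_adPowers.mpr ⟨y, hy, 0, by simp, by simp⟩))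
      -- Stopping at `i = q` loses nothing: `(ad x)^(i+1) y` has weight above `q` once `i + 1 > q`.
      have hxz : ∀ z ∈ Z, ⁅x, z⁆ = 0 ∨ ∃ y ∈ B', y.1 = ⁅x, z⁆ := by
        rintro _ ⟨y, hy, rfl⟩
        rw [hB', Multiset.mem_add, Multiset.mem_add] at hy
        have hstep : ∀ y' : N × ℕ, ∀ i, y'.1 ∈ Fil y'.2 → 1 ≤ y'.2 →
            ⁅x, ((LieAlgebra.ad K N x) ^ i) y'.1⁆ = 0 ∨ i + 1 ≤ q := by
          intro y' i h1 h2
          by_cases hi : i + 1 ≤ q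
          · exact Or.inr hi
          · left
            have h3 := ad_pow_mem hFil hx h1 (i + 1)
            rw [hq, Submodule.mem_bot, pow_succ'] at h3
            · simpa using h3
            · have := Nat.mul_le_mul_left (i + 1) hd
              omega
        have hsucc : ∀ (y' : N) (i : ℕ), ((LieAlgebra.ad K N x) ^ (i + 1)) y' =
            ⁅x, ((LieAlgebra.ad K N x) ^ i) y'⁆ := fun y' i => by rw [pow_succ']; simp
        rcases hy with hy | hy | hy
        · rcases hstep y 0 (hAC y hy).2 (by have := (hAC y hy).1; omega) with h | h
          · left; simpa using h
          · right
            exact ⟨_, Multiset.mem_add.mpr (Or.inl (mem_adPowers.mpr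
              ⟨y, hy, 1, Finset.mem_Ioc.mpr ⟨by omega, by omega⟩, rfl⟩)), by simp⟩
        · obtain ⟨y', hy', i, hi, rfl⟩ := mem_adPowers.mp hy
          refine (hstep y' i (hAC y' hy').2 (by have := (hAC y' hy').1; omega)).imp_right
            fun h => ?_
          exact ⟨_, Multiset.mem_add.mpr (Or.inl (mem_adPowers.mpr
              ⟨y', hy', i + 1, Finset.mem_Ioc.mpr ⟨by omega, h⟩, rfl⟩)), hsucc _ _⟩
        · obtain ⟨y', hy', i, hi, rfl⟩ := mem_adPowers.mp hy
          refine (hstep y' i (hB y' hy').2 (by have := (hB y' hy').1; omega)).imp_right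
            fun h => ?_
          exact ⟨_, Multiset.mem_add.mpr (Or.inr (mem_adPowers.mpr
              ⟨y', hy', i + 1, Finset.mem_Icc.mpr ⟨by omega, h⟩, rfl⟩)), hsucc _ _⟩
      refine ⟨b, hb1, fun y hy => hb2 y (hBB' y hy), fun u hu v hv => ?_, ?_⟩
      · refine lie_smul_add_mem (x := x) (Z := Z) (fun z hz => ?_) (fun z hz => ?_) hb3
          (fun y hy => ?_) hu hv
        · rcases hxz z hz with h | ⟨y, hy, h⟩
          · rw [h]; exact zero_mem _
          · exact LieSubalgebra.subset_lieSpan ⟨y, Multiset.mem_add.mpr (Or.inr hy), h⟩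
        · rcases hxz z hz with h | ⟨y, hy, h⟩
          · rw [h]; exact zero_mem _
          · rw [← h]; exact hb2 y hy
        · obtain ⟨y, hy, rfl⟩ := hy
          rw [Multiset.cons_add, Multiset.mem_cons, Multiset.mem_add] at hy
          rcases hy with rfl | hy | hy
          · exact Or.inl rfl
          · exact Or.inr (LieSubalgebra.subset_lieSpan ⟨y, Multiset.mem_add.mpr (Or.inl hy), rfl⟩)
          · exact Or.inr (LieSubalgebra.subset_lieSpan
              ⟨y, Multiset.mem_add.mpr (Or.inr (hBB' y hy)), rfl⟩)
      · have hprod : weightProd ((x, w) ::ₘ A) = (1 - X ^ w) * weightProd A := by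
          simp [weightProd]
        have hser : weightSeries ((x, w) ::ₘ A + B) =
            X ^ w + (weightSeries A + weightSeries B) := by
          rw [weightSeries_add]; simp [weightSeries, add_assoc]
        have hsum : ∑ i ∈ Finset.Icc 0 q, ((X : ℚ⟦X⟧) ^ w) ^ i =
            1 + ∑ i ∈ Finset.Ioc 0 q, ((X : ℚ⟦X⟧) ^ w) ^ i := by
          rw [← Finset.add_sum_Ioc_eq_sum_Icc (Nat.zero_le q), pow_zero]
        have hgeom : (1 - (X : ℚ⟦X⟧) ^ w) * ∑ i ∈ Finset.Icc 0 q, ((X : ℚ⟦X⟧) ^ w) ^ i =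
            1 - (X ^ w) ^ (q + 1) := by
          rw [← Nat.range_succ_eq_Icc_zero, mul_neg_geom_sum]
        have hlast : (X : ℚ⟦X⟧) ^ (q + 1) ∣ (X ^ w) ^ (q + 1) := by
          rw [← pow_mul]; exact pow_dvd_pow _ (Nat.le_mul_of_pos_left _ hd)
        rw [hB', weightSeries_add, weightSeries_add, weightSeries_adPowers,
          weightSeries_adPowers] at hb4
        rw [hprod, hser]
        -- The second summand is the tail of the truncated geometric series.
        refine (dvd_add (hb4.mul_left (1 - X ^ w))
          (hlast.mul_left (weightSeries A + weightSeries B))).trans (dvd_of_eq ?_)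
        linear_combination (weightSeries A + weightSeries B) * hgeom -
          (1 - X ^ w) * weightSeries A * hsum

end Elimination

/-! ### From nilpotent algebras to the Schur multiplier. -/

section SchurMultiplierBound

open PowerSeries

variable {K N : Type*} [Field K] [LieRing N] [LieAlgebra K N]

/-- By induction through the Jacobi identity. Index `i` stands for `L^(i+1)`, whence the extra `1`.
-/
theorem lie_mem_lowerCentralSeries_add {i j : ℕ} {u v : N}
    (hu : u ∈ LieModule.lowerCentralSeries K N N i)
    (hv : v ∈ LieModule.lowerCentralSeries K N N j) :
    ⁅u, v⁆ ∈ LieModule.lowerCentralSeries K N N (i + j + 1) := by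
  induction i generalizing u v j with
  | zero =>
    rw [zero_add, LieModule.lowerCentralSeries_succ]
    exact LieSubmodule.lie_mem_lie (LieSubmodule.mem_top u) hv
  | succ i ih =>
    rw [LieModule.lowerCentralSeries_succ, ← LieSubmodule.mem_toSubmodule,
      LieSubmodule.lieIdeal_oper_eq_linear_span'] at hu
    induction hu using Submodule.span_induction with
    | mem u hu =>
      obtain ⟨a, -, b, hb, rfl⟩ := hu
      rw [lie_lie]
      refine sub_mem ?_ ?_
      · rw [show i + 1 + j + 1 = (i + j + 1) + 1 by ring, LieModule.lowerCentralSeries_succ]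
        exact LieSubmodule.lie_mem_lie (LieSubmodule.mem_top a) (ih hb hv)
      · rw [show i + 1 + j + 1 = i + (j + 1) + 1 by ring]
        refine ih hb ?_
        rw [LieModule.lowerCentralSeries_succ]
        exact LieSubmodule.lie_mem_lie (LieSubmodule.mem_top a) hv
    | zero => rw [zero_lie]; exact zero_mem _
    | add a b _ _ ha hb => rw [add_lie]; exact add_mem ha hb
    | smul t a _ ha => rw [smul_lie]; exact SMulMemClass.smul_mem t ha

/-- If `N ^ (q + 1) = 0`, then the commutators of a subalgebra of `N` with `n` generators span a
space of dimension at most `∑_{m = 2}^q l_n(m)`. -/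
theorem exists_finiteDimensional_forall_lie_mem {q : ℕ}
    (hN : LieModule.lowerCentralSeries K N N q = ⊥) {n : ℕ} (x : Fin n → N) :
    ∃ V : Submodule K N, Module.Finite K V ∧
      (Module.finrank K V : ℚ) ≤ ∑ m ∈ Finset.Icc 2 q, wittNumber n m ∧
      ∀ u ∈ LieSubalgebra.lieSpan K N (Set.range x),
        ∀ v ∈ LieSubalgebra.lieSpan K N (Set.range x), ⁅u, v⁆ ∈ V := by
  classical
  -- `Fil m` is `N^m`, with `Fil 0 = N` by truncated subtraction.
  set Fil : ℕ → Submodule K N := fun m => (LieModule.lowerCentralSeries K N N (m - 1)).toSubmodule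
    with hF
  have hFil : ∀ i j, ∀ u ∈ Fil i, ∀ v ∈ Fil j, ⁅u, v⁆ ∈ Fil (i + j) := fun i j u hu v hv =>
    LieModule.antitone_lowerCentralSeries K N N (by omega : i + j - 1 ≤ i - 1 + (j - 1) + 1)
      (lie_mem_lowerCentralSeries_add hu hv)
  have hq : ∀ m, q < m → Fil m = ⊥ := by
    intro m hm
    have h := LieModule.antitone_lowerCentralSeries K N N (by omega : q ≤ m - 1)
    rw [hN, le_bot_iff] at h
    simp [hF, h]
  set A : Multiset (N × ℕ) := Finset.univ.val.map fun i => (x i, 1) with hA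
  obtain ⟨b, hb1, -, hb3, hb4⟩ := exists_spanning_family Fil hFil hq (k := q) le_rfl le_rfl A 0
    (by simp [hA, hF]) (by simp)
  -- Elements of weight above `q` are zero and would spoil the count.
  set b' := b.filter fun z => z.2 ≤ q with hb'
  set V := Submodule.span K ((b'.map Prod.fst).toFinset : Set N) with hV
  have hbV : Submodule.span K {z | ∃ y ∈ b, y.1 = z} ≤ V := by
    rw [Submodule.span_le]
    rintro _ ⟨y, hy, rfl⟩
    by_cases h : y.2 ≤ q
    · refine Submodule.subset_span ?_
      rw [Finset.mem_coe, Multiset.mem_toFinset]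
      exact Multiset.mem_map_of_mem _ (Multiset.mem_filter.mpr ⟨hy, h⟩)
    · have h1 := (hb1 y hy).2
      rw [hq _ (by omega), Submodule.mem_bot] at h1
      rw [SetLike.mem_coe, h1]
      exact zero_mem _
  set W := A.map Prod.snd + b.map Prod.snd with hW
  have hW1 : ∀ w ∈ W, 1 ≤ w := by
    intro w hw
    rcases Multiset.mem_add.mp hw with h | h
    · obtain ⟨y, hy, rfl⟩ := Multiset.mem_map.mp h
      obtain ⟨i, -, rfl⟩ := Multiset.mem_map.mp hy
      exact le_rfl
    · obtain ⟨y, hy, rfl⟩ := Multiset.mem_map.mp h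
      exact (hb1 y hy).1.le
  have hW2 : (X : ℚ⟦X⟧) ^ (q + 1) ∣
      (W.map fun w => 1 - (X : ℚ⟦X⟧) ^ w).prod - (1 - (n : ℚ⟦X⟧) * X) := by
    refine hb4.trans (dvd_of_eq ?_)
    simp [hW, hA, weightProd, weightSeries, Function.comp_def]
  have hcard : b'.card ≤ ∑ m ∈ Finset.Icc 2 q, W.count m := by
    rw [← Multiset.card_map Prod.snd b', ← Multiset.sum_count_eq_card (s := Finset.Icc 2 q)]
    · refine Finset.sum_le_sum fun m _ => Multiset.count_le_of_le m ?_
      exact (Multiset.map_le_map (Multiset.filter_le _ b)).trans (Multiset.le_add_left _ _)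
    · intro m hm
      obtain ⟨y, hy, rfl⟩ := Multiset.mem_map.mp hm
      obtain ⟨h1, h2⟩ := Multiset.mem_filter.mp hy
      exact Finset.mem_Icc.mpr ⟨(hb1 y h1).1, h2⟩
  refine ⟨V, inferInstance, ?_, fun u hu v hv => hbV (hb3 u ?_ v ?_)⟩
  · have h1 : Module.finrank K V ≤ b'.card :=
      (finrank_span_finset_le_card _).trans
        ((Multiset.toFinset_card_le _).trans (Multiset.card_map _ _).le)
    have h2 : ((∑ m ∈ Finset.Icc 2 q, W.count m : ℕ) : ℚ) =
        ∑ m ∈ Finset.Icc 2 q, wittNumber n m := by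
      rw [Nat.cast_sum]
      refine Finset.sum_congr rfl fun m hm => ?_
      obtain ⟨hm1, hm2⟩ := Finset.mem_Icc.mp hm
      exact count_eq_wittNumber W hW1 hW2 (by omega) hm2
    rw [← h2]
    exact_mod_cast h1.trans hcard
  · refine LieSubalgebra.lieSpan_mono ?_ hu
    rintro _ ⟨i, rfl⟩
    exact ⟨(x i, 1), by simp [hA], rfl⟩
  · refine LieSubalgebra.lieSpan_mono ?_ hv
    rintro _ ⟨i, rfl⟩
    exact ⟨(x i, 1), by simp [hA], rfl⟩

variable {F L : Type*} [LieRing F] [LieAlgebra K F] [LieRing L] [LieAlgebra K L]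

/-- The projection of a Lie algebra onto the quotient by an ideal, as a homomorphism of Lie
algebras. -/
def LieIdeal.quotientHom (I : LieIdeal K F) : F →ₗ⁅K⁆ F ⧸ I where
  toLinearMap := (LieSubmodule.Quotient.mk' I : F →ₗ[K] F ⧸ I)
  map_lie' := rfl

theorem LieIdeal.quotientHom_eq_zero {I : LieIdeal K F} {f : F} :
    I.quotientHom f = 0 ↔ f ∈ I :=
  LieSubmodule.Quotient.mk_eq_zero I

theorem LieIdeal.quotientHom_surjective (I : LieIdeal K F) :
    Function.Surjective I.quotientHom :=
  LieSubmodule.Quotient.surjective_mk' I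

/-- If `F / R` has class at most `c`, then `F / [F, R]` has class at most `c + 1`. -/
theorem lowerCentralSeries_quotient_lie_ker_eq_bot (p : F →ₗ⁅K⁆ L) {c : ℕ}
    (hL : LieModule.lowerCentralSeries K L L c = ⊥) :
    LieModule.lowerCentralSeries K (F ⧸ ⁅(⊤ : LieIdeal K F), p.ker⁆)
      (F ⧸ ⁅(⊤ : LieIdeal K F), p.ker⁆) (c + 1) = ⊥ := by
  have h1 : LieModule.lowerCentralSeries K F F c ≤ p.ker := by
    have := LieIdeal.map_lowerCentralSeries_le c (f := p)
    rwa [hL, le_bot_iff, LieIdeal.map_eq_bot_iff] at this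
  have h2 : LieModule.lowerCentralSeries K F F (c + 1) ≤ ⁅(⊤ : LieIdeal K F), p.ker⁆ := by
    rw [LieModule.lowerCentralSeries_succ]
    exact LieSubmodule.mono_lie_right _ h1
  rw [← LieIdeal.lowerCentralSeries_map_eq (c + 1)
    (LieIdeal.quotientHom_surjective ⁅(⊤ : LieIdeal K F), p.ker⁆), LieIdeal.map_eq_bot_iff]
  exact fun f hf => LieHom.mem_ker.mpr (LieIdeal.quotientHom_eq_zero.mpr (h2 hf))

/-- The bound holds for the Hopf quotient of any surjection onto `L`, free or not. -/
theorem SchurMultiplier.finite_and_finrank_le (p : F →ₗ⁅K⁆ L) (hp : Function.Surjective p) {c : ℕ}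
    (hL : LieModule.lowerCentralSeries K L L c = ⊥) {n : ℕ} (x : Fin n → L)
    (hx : LieSubalgebra.lieSpan K L (Set.range x) = ⊤) :
    Module.Finite K (SchurMultiplier p) ∧
      (Module.finrank K (SchurMultiplier p) : ℚ) ≤
        ∑ m ∈ Finset.Icc 2 (c + 1), wittNumber n m := by
  choose y hy using fun i => hp (x i)
  set I : LieIdeal K F := ⁅(⊤ : LieIdeal K F), p.ker⁆ with hI
  obtain ⟨V, hV1, hV2, hV3⟩ := exists_finiteDimensional_forall_lie_mem
    (lowerCentralSeries_quotient_lie_ker_eq_bot p hL) fun i => I.quotientHom (y i)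
  have hdecomp : ∀ f : F, ∃ a ∈ LieSubalgebra.lieSpan K F (Set.range y), ∃ r ∈ p.ker,
      f = a + r := by
    intro f
    have h1 : p f ∈ (LieSubalgebra.lieSpan K F (Set.range y)).map p := by
      rw [LieSubalgebra.map_lieSpan, ← Set.range_comp, show p ∘ y = x from funext hy, hx]
      exact LieSubalgebra.mem_top _
    obtain ⟨a, ha, hpa⟩ := (LieSubalgebra.mem_map _ _ _).mp h1
    refine ⟨a, ha, f - a, ?_, by abel⟩
    rw [LieHom.mem_ker, map_sub, hpa, sub_self]
  have hspan : ∀ a ∈ LieSubalgebra.lieSpan K F (Set.range y), I.quotientHom a ∈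
      LieSubalgebra.lieSpan K (F ⧸ I) (Set.range fun i => I.quotientHom (y i)) := by
    intro a ha
    have h1 := LieSubalgebra.map_lieSpan (f := I.quotientHom) (s := Set.range y)
    rw [← Set.range_comp] at h1
    exact h1.le ((LieSubalgebra.mem_map _ _ _).mpr ⟨a, ha, rfl⟩)
  have hder : ∀ f ∈ ⁅(⊤ : LieIdeal K F), (⊤ : LieIdeal K F)⁆, I.quotientHom f ∈ V := by
    intro f hf
    rw [← LieSubmodule.mem_toSubmodule, LieSubmodule.lieIdeal_oper_eq_linear_span'] at hf
    suffices h : Submodule.span K {m : F | ∃ u ∈ (⊤ : LieIdeal K F), ∃ v ∈ (⊤ : LieIdeal K F),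
        ⁅u, v⁆ = m} ≤ V.comap (I.quotientHom : F →ₗ[K] F ⧸ I) from h hf
    rw [Submodule.span_le]
    rintro _ ⟨u, -, v, -, rfl⟩
    obtain ⟨a, ha, r, hr, rfl⟩ := hdecomp u
    obtain ⟨b, hb, s, hs, rfl⟩ := hdecomp v
    -- `R` becomes central modulo `[F,R]`, so only the bracket of the lifted parts survives.
    have h1 : ∀ w : F, I.quotientHom ⁅w, s⁆ = 0 := fun w =>
      LieIdeal.quotientHom_eq_zero.mpr (LieSubmodule.lie_mem_lie (LieSubmodule.mem_top w) hs)
    have h2 : I.quotientHom ⁅r, b⁆ = 0 := by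
      rw [← lie_skew, map_neg, LieIdeal.quotientHom_eq_zero.mpr
        (LieSubmodule.lie_mem_lie (LieSubmodule.mem_top b) hr), neg_zero]
    change I.quotientHom ⁅a + r, b + s⁆ ∈ V
    rw [lie_add, map_add, h1, add_lie, map_add, h2, add_zero, add_zero, LieHom.map_lie]
    exact hV3 _ (hspan a ha) _ (hspan b hb)
  let S := (⁅(⊤ : LieIdeal K F), (⊤ : LieIdeal K F)⁆ ⊓ p.ker : LieIdeal K F).toSubmodule
  let g : S →ₗ[K] V := ((I.quotientHom : F →ₗ[K] F ⧸ I).comp S.subtype).codRestrict V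
    fun f => hder f f.2.1
  have hg : LinearMap.ker g = I.toSubmodule.comap S.subtype := by
    ext f
    rw [LinearMap.mem_ker, Submodule.mem_comap, ← Submodule.coe_eq_zero]
    exact LieIdeal.quotientHom_eq_zero
  have hinj : Function.Injective ((I.toSubmodule.comap S.subtype).liftQ g hg.ge) :=
    LinearMap.ker_eq_bot.mp (Submodule.ker_liftQ_eq_bot _ _ _ hg.le)
  exact ⟨Module.Finite.of_injective _ hinj, le_trans
    (Nat.cast_le.mpr (LinearMap.finrank_le_finrank_of_injective hinj)) hV2⟩

theorem lowerCentralSeries_eq_bot_of_nilpotencyLength_eq [LieRing.IsNilpotent L] {c : ℕ}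
    (hc : LieModule.nilpotencyLength L L = c) : LieModule.lowerCentralSeries K L L c = ⊥ := by
  cases c with
  | zero =>
    have := (LieModule.nilpotencyLength_eq_zero_iff L L).mp hc
    exact Subsingleton.elim _ _
  | succ c => exact ((LieModule.nilpotencyLength_eq_succ_iff K L L c).mp hc).1

end SchurMultiplierBound

theorem theoremM {K : Type*} [Field K] {L : Type*} [LieRing L] [LieAlgebra K L]
    [LieRing.IsNilpotent L] (c : ℕ) (hc : LieModule.nilpotencyLength L L = c)
    (n : ℕ) (x : Fin n → L) (hx : LieSubalgebra.lieSpan K L (Set.range x) = ⊤)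
    {X : Type*} (p : FreeLieAlgebra K X →ₗ⁅K⁆ L) (hp : Function.Surjective p) :
    Module.Finite K (SchurMultiplier p) ∧
      (Module.finrank K (SchurMultiplier p) : ℚ) ≤ ∑ j ∈ Finset.Icc 1 c, wittNumber n (j + 1) := by
  have h := SchurMultiplier.finite_and_finrank_le p hp
    (lowerCentralSeries_eq_bot_of_nilpotencyLength_eq hc) x hx
  refine ⟨h.1, h.2.trans (le_of_eq ?_)⟩
  rw [show Finset.Icc 2 (c + 1) = (Finset.Icc 1 c).map (addRightEmbedding 1) from
    (Finset.map_add_right_Icc 1 c 1).symm, Finset.sum_map]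
  rfl
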